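/- For $N\ge 1$ and $\underline{\zeta}=(\zeta_1,\ldots,\zeta_N)\in\mathbb{R}^N$ let $\widehat{\lambda}_N(\underline{\zeta})$ denote the uniform exponent of simultaneous approximation, that is, the supremum of all real $\lambda$ such that the system $$1\le |x|\le X,\qquad \max_{1\le j\le N}|\zeta_j x-y_j|\le X^{-\lambda}$$ has a solution $(x,y_1,\ldots,y_N)\in\mathbb{Z}^{N+1}$ for all sufficiently large real $X$. Let $k\ge n\ge 1$ be integers and let $\underline{\xi}=(\xi_1,\xi_2,\ldots)$ be an infinite vector of real numbers. For $N\ge 1$ put $\underline{\xi}_N=(\xi_1,\ldots,\xi_N)$. Assume that $1,\xi_1,\ldots,\xi_k$ are linearly independent over $\mathbb{Q}$. If $$\widehat{\lambda}_n(\underline{\xi}_n)>\frac{k-n+1}{n},$$ then $$\widehat{\lambda}_k(\underline{\xi}_k)\ \ge\ \frac{\widehat{\lambda}_n(\underline{\xi}_n)+n-2}{(n-1)(k-1)}\ >\ \frac1k .$$ (For $n=1$ the hypothesis never holds, since $\widehat{\lambda}_1(\xi_1)=1$ for irrational $\xi_1$, so the denominator does not vanish.) -/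

import Mathlib

open Filter

/-- The system `1 ≤ |x| ≤ X`, `max_j |ξ_j x - y_j| ≤ X ^ (-l)` has a solution
`(x, y_1, …, y_N)` in integers. -/
def SimultaneouslySolvable {N : ℕ} (ξ : Fin N → ℝ) (l X : ℝ) : Prop :=
  ∃ (x : ℤ) (y : Fin N → ℤ), 1 ≤ |(x : ℝ)| ∧ |(x : ℝ)| ≤ X ∧
    ∀ j, |ξ j * (x : ℝ) - (y j : ℝ)| ≤ X ^ (-l)

/-- The uniform exponent of simultaneous rational approximation of `ξ ∈ ℝ^N`: the supremum, in the
extended reals, of the real numbers `l` such that the system is solvable for all large `X`. -/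
noncomputable def uniformExponent {N : ℕ} (ξ : Fin N → ℝ) : EReal :=
  sSup ((fun l : ℝ => (l : EReal)) '' {l : ℝ | ∀ᶠ X : ℝ in atTop, SimultaneouslySolvable ξ l X})

/-- The projection of an infinite vector to its first `N` entries. The entries are counted from `0`
here, so that `ξ 0, ξ 1, …` stand for `ξ_1, ξ_2, …`. -/
def initialEntries (ξ : ℕ → ℝ) (N : ℕ) : Fin N → ℝ := fun j => ξ j

/-! Write $\hat w_N$ for the uniform exponent of the linear form $z_0+\sum\xi_jz_j$. The theorem
composes German's transference inequalities $\hat w_n\ge(n-1)/(1-\hat\lambda_n)$ and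
$\hat\lambda_k\ge(1-1/\hat w_k)/(k-1)$ with $\hat w_k\ge\hat w_n$; the hypothesis serves only to
exclude $n=1$ and to beat $1/k$.

Both inequalities come from `exists_int_ne_zero_of_dual`. Take a minimal point $r$ of the dual
lattice. An integer-valued form that Minkowski's theorem makes smaller than 1 vanishes, and the
resulting relation bounds a coordinate left free. If $r_0$ is relatively small, $r$ alone is enough.
Otherwise uniformity gives a second dual point $s$, which minimality keeps from being proportional
to $r$; the minors $r_0s_j-r_js_0$ are small, and eliminating $u_0$ from $r\cdot u=s\cdot u=0$
bounds the remaining coordinate. -/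

/-! ### Geometry of numbers -/

open MeasureTheory in
/-- **Minkowski's linear forms theorem**, with strict inequalities. -/
theorem Matrix.exists_int_ne_zero_abs_mulVec_lt {ι : Type*} [Fintype ι] [DecidableEq ι]
    (M : Matrix ι ι ℝ) (hM : M.det ≠ 0) (c : ι → ℝ) (hc : ∀ i, 0 < c i)
    (h : |M.det| < ∏ i, c i) :
    ∃ z : ι → ℤ, z ≠ 0 ∧ ∀ i, |(M.mulVec fun i => (z i : ℝ)) i| < c i := by
  classical
  set S : Set (ι → ℝ) := Set.univ.pi fun i => Set.Ioo (-c i) (c i) with hS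
  have hmem : ∀ x, x ∈ (Matrix.toLin' M) ⁻¹' S ↔ ∀ i, |M.mulVec x i| < c i := by
    intro x
    simp [hS, abs_lt]
  have hfund := ZSpan.isAddFundamentalDomain' (Pi.basisFun ℝ ι) volume
  have hvol : volume (ZSpan.fundamentalDomain (Pi.basisFun ℝ ι)) = 1 := by
    simp [ZSpan.fundamentalDomain_pi_basisFun, volume_pi, Measure.pi_pi]
  have hcount : Countable (Submodule.span ℤ (Set.range (Pi.basisFun ℝ ι))).toAddSubgroup := by
    change Countable (Submodule.span ℤ (Set.range (Pi.basisFun ℝ ι)))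
    infer_instance
  have hdet : LinearMap.det (Matrix.toLin' M) ≠ 0 := by
    rwa [LinearMap.det_toLin']
  have hconv : Convex ℝ ((Matrix.toLin' M) ⁻¹' S) :=
    (convex_pi fun i _ => convex_Ioo _ _).linear_preimage _
  have hsymm : ∀ x ∈ (Matrix.toLin' M) ⁻¹' S, -x ∈ (Matrix.toLin' M) ⁻¹' S := by
    intro x hx
    rw [hmem] at hx ⊢
    intro i
    simpa [Matrix.mulVec_neg] using hx i
  obtain ⟨x, hx0, hx⟩ := exists_ne_zero_mem_lattice_of_measure_mul_two_pow_lt_measure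
    hfund hsymm hconv (by
      rw [hvol, one_mul, Measure.addHaar_preimage_linearMap _ hdet, hS, Real.volume_pi_Ioo,
        LinearMap.det_toLin', ← ENNReal.ofReal_prod_of_nonneg
          (fun i _ => by linarith [hc i]), ← ENNReal.ofReal_mul (abs_nonneg _),
        Module.finrank_fintype_fun_eq_card]
      have : (2 : ENNReal) ^ Fintype.card ι = ENNReal.ofReal (2 ^ Fintype.card ι) := by
        rw [ENNReal.ofReal_pow (by norm_num)]
        norm_num
      rw [this, ENNReal.ofReal_lt_ofReal_iff_of_nonneg (by positivity)]
      have h2 : ∏ i, (c i - -c i) = 2 ^ Fintype.card ι * ∏ i, c i := by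
        rw [← Finset.card_univ, ← Finset.prod_const, ← Finset.prod_mul_distrib]
        exact Finset.prod_congr rfl fun i _ => by ring
      rw [h2, abs_inv, inv_mul_eq_div, lt_div_iff₀ (abs_pos.2 hM)]
      gcongr)
  have hz := fun i => ((Pi.basisFun ℝ ι).mem_span_iff_repr_mem ℤ (x : ι → ℝ)).mp x.2 i
  simp only [Pi.basisFun_repr] at hz
  choose z hz using hz
  have hzx : (fun i => (z i : ℝ)) = x := by
    ext i
    simpa using hz i
  refine ⟨z, ?_, ?_⟩
  · rintro rfl
    apply hx0
    ext i
    simp [← hzx]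
  · rw [hzx]
    exact (hmem _).1 hx

/-- A rank-two perturbation of the identity: $\det(1+BC)=\det(1+CB)$ leaves a $2\times2$
determinant. -/
theorem Matrix.det_two_rows_replaced {k : ℕ} (r s : Fin (k + 1) → ℝ) (J : Fin k) :
    (Matrix.of fun i => if i = 0 then r else if i = J.succ then s else Pi.single i 1 :
      Matrix (Fin (k + 1)) (Fin (k + 1)) ℝ).det = r 0 * s J.succ - r J.succ * s 0 := by
  have hJ : J.succ ≠ 0 := Fin.succ_ne_zero J
  let B : Matrix (Fin (k + 1)) (Fin 2) ℝ :=
    Matrix.of fun i => ![if i = 0 then 1 else 0, if i = J.succ then 1 else 0]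
  let C : Matrix (Fin 2) (Fin (k + 1)) ℝ :=
    Matrix.of ![r - Pi.single 0 1, s - Pi.single J.succ 1]
  have h1 : (Matrix.of fun i => if i = 0 then r else if i = J.succ then s else Pi.single i 1 :
      Matrix (Fin (k + 1)) (Fin (k + 1)) ℝ) = 1 + B * C := by
    ext i j
    by_cases hi : i = 0
    · subst hi
      simp [B, C, Matrix.mul_apply, Fin.sum_univ_two, hJ.symm, Matrix.one_apply, Pi.single_apply,
        eq_comm]
    · by_cases hi' : i = J.succ
      · subst hi'
        simp [B, C, Matrix.mul_apply, Fin.sum_univ_two, hJ, Matrix.one_apply, Pi.single_apply,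
          eq_comm]
      · simp [B, C, Matrix.mul_apply, Fin.sum_univ_two, hi, hi', Matrix.one_apply,
          Pi.single_apply, eq_comm]
  rw [h1, Matrix.det_one_add_mul_comm, Matrix.det_fin_two]
  simp [B, C, Matrix.vecMul, dotProduct, hJ, hJ.symm]

/-- A unimodular lattice contains a nonzero point at which two prescribed linear forms and all but
two of the coordinates are small. -/
theorem exists_int_two_forms_lt {k : ℕ} (P : Matrix (Fin (k + 1)) (Fin (k + 1)) ℝ)
    (hP : |P.det| = 1) (r s : Fin (k + 1) → ℝ) (J : Fin k) {c₀ c₁ δ : ℝ} (hc₀ : 0 < c₀)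
    (hc₁ : 0 < c₁) (hδ : 0 < δ) (h0 : r 0 * s J.succ - r J.succ * s 0 ≠ 0)
    (h : |r 0 * s J.succ - r J.succ * s 0| < c₀ * c₁ * δ ^ (k - 1)) :
    ∃ z : Fin (k + 1) → ℤ, z ≠ 0 ∧ |r ⬝ᵥ P.mulVec fun i => (z i : ℝ)| < c₀ ∧
      |s ⬝ᵥ P.mulVec fun i => (z i : ℝ)| < c₁ ∧
      ∀ j, j ≠ J → |(P.mulVec fun i => (z i : ℝ)) j.succ| < δ := by
  have hP0 : P.det ≠ 0 := by
    intro h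
    simp [h] at hP
  set M : Matrix (Fin (k + 1)) (Fin (k + 1)) ℝ :=
    Matrix.of fun i => if i = 0 then r else if i = J.succ then s else Pi.single i 1 with hMdef
  have hMdet := Matrix.det_two_rows_replaced r s J
  rw [← hMdef] at hMdet
  obtain ⟨z, hz0, hz⟩ := Matrix.exists_int_ne_zero_abs_mulVec_lt (M * P)
    (by rw [Matrix.det_mul, hMdet]; exact mul_ne_zero h0 hP0)
    (Fin.cons c₀ fun j => if j = J then c₁ else δ)
    (by
      intro i
      refine Fin.cases ?_ (fun j => ?_) i
      · simpa
      · simp only [Fin.cons_succ]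
        split_ifs <;> assumption)
    (by
      rw [Matrix.det_mul, hMdet, abs_mul, hP, mul_one, Fin.prod_univ_succ]
      simp only [Fin.cons_zero, Fin.cons_succ]
      rw [← Finset.mul_prod_erase _ _ (Finset.mem_univ J), if_pos rfl,
        Finset.prod_congr rfl (g := fun _ => δ) (fun j hj => if_neg (Finset.ne_of_mem_erase hj)),
        Finset.prod_const, Finset.card_erase_of_mem (Finset.mem_univ J), Finset.card_univ,
        Fintype.card_fin, ← mul_assoc]
      exact h)
  have hrow : ∀ i, ((M * P).mulVec fun i => (z i : ℝ)) i = M i ⬝ᵥ P.mulVec fun i => (z i : ℝ) := by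
    intro i
    rw [← Matrix.mulVec_mulVec]
    rfl
  have hM0 : M 0 = r := by
    ext j
    simp [hMdef]
  have hMJ : M J.succ = s := by
    ext j
    simp [hMdef]
  have hMj : ∀ j, j ≠ J → M j.succ = Pi.single j.succ 1 := by
    intro j hj
    ext i
    simp [hMdef, hj]
  refine ⟨z, hz0, ?_, ?_, fun j hj => ?_⟩
  · have := hz 0
    rw [hrow] at this
    simpa [hM0] using this
  · have := hz J.succ
    rw [hrow] at this
    simpa [hMJ] using this
  · have := hz j.succ
    rw [hrow] at this
    simpa [hMj j hj, hj, single_one_dotProduct] using this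

/-! ### Transference from the dual lattice -/

/-- Solve the relation for the coordinate with the largest coefficient: the $k-1$ other terms and
$e$ each cost at most $\delta$. -/
theorem abs_le_of_sum_mul_eq {k : ℕ} (D u : Fin k → ℝ) (J : Fin k) {δ e : ℝ}
    (hD : ∀ j, |D j| ≤ |D J|) (hJ : D J ≠ 0) (hu : ∀ j, j ≠ J → |u j| ≤ δ)
    (he : |e| ≤ |D J| * δ) (hsum : ∑ j, D j * u j = e) : |u J| ≤ k * δ := by
  have hpos : 0 < |D J| := abs_pos.2 hJ
  have h1 : D J * u J = e - ∑ j ∈ Finset.univ.erase J, D j * u j := by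
    rw [← hsum, ← Finset.add_sum_erase _ _ (Finset.mem_univ J)]
    ring
  have h2 : |∑ j ∈ Finset.univ.erase J, D j * u j| ≤ ((k : ℝ) - 1) * (|D J| * δ) := by
    refine (Finset.abs_sum_le_sum_abs _ _).trans ?_
    refine (Finset.sum_le_card_nsmul _ _ (|D J| * δ) fun j hj => ?_).trans_eq ?_
    · rw [abs_mul]
      exact mul_le_mul (hD j) (hu j (Finset.ne_of_mem_erase hj)) (abs_nonneg _) hpos.le
    · rw [Finset.card_erase_of_mem (Finset.mem_univ J), Finset.card_univ, Fintype.card_fin,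
        nsmul_eq_mul, Nat.cast_sub (Fin.pos J), Nat.cast_one]
  have h3 : |D J| * |u J| ≤ |D J| * (k * δ) := by
    rw [← abs_mul, h1]
    have := abs_sub e (∑ j ∈ Finset.univ.erase J, D j * u j)
    linarith
  exact le_of_mul_le_mul_left h3 hpos

/-- Transference: a small vector `r` of the dual lattice, together with a second such vector when
`r` has a large initial entry, yields a small nonzero point of a unimodular lattice. -/
theorem exists_int_ne_zero_of_dual {k : ℕ} (P : Matrix (Fin (k + 1)) (Fin (k + 1)) ℝ)
    (hP : |P.det| = 1) (r : Fin (k + 1) → ℝ)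
    (hr : ∀ z : Fin (k + 1) → ℤ, ∃ m : ℤ, (r ⬝ᵥ P.mulVec fun i => (z i : ℝ)) = m)
    {U δ : ℝ} (hU : 0 < U) (hδ : 0 < δ) (J : Fin k) (hJ : ∀ j : Fin k, |r j.succ| ≤ |r J.succ|)
    (hJ0 : r J.succ ≠ 0) (hJU : |r J.succ| < U * δ ^ (k - 1))
    (h2 : |r J.succ| * δ < |r 0| * U → ∃ s : Fin (k + 1) → ℝ,
      (∀ z : Fin (k + 1) → ℤ, ∃ m : ℤ, (s ⬝ᵥ P.mulVec fun i => (z i : ℝ)) = m) ∧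
      (∀ j : Fin k, |r 0 * s j.succ - r j.succ * s 0| < δ ^ (k - 1)) ∧
      ∃ j : Fin k, r 0 * s j.succ - r j.succ * s 0 ≠ 0) :
    ∃ z : Fin (k + 1) → ℤ, z ≠ 0 ∧ |(P.mulVec fun i => (z i : ℝ)) 0| ≤ k ^ 2 * U ∧
      ∀ j : Fin k, |(P.mulVec fun i => (z i : ℝ)) j.succ| ≤ k * δ := by
  have hk1 : (1 : ℝ) ≤ k := by exact_mod_cast Fin.pos J
  have hzero : ∀ {x : ℝ}, (∃ m : ℤ, x = m) → |x| < 1 → x = 0 := by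
    rintro x ⟨m, rfl⟩ h
    have : |m| < 1 := by exact_mod_cast h
    rw [Int.abs_lt_one_iff.1 this, Int.cast_zero]
  have hδk : δ ≤ k * δ := le_mul_of_one_le_left hδ.le hk1
  have hdot : ∀ a b : Fin (k + 1) → ℝ, a ⬝ᵥ b = a 0 * b 0 + ∑ j : Fin k, a j.succ * b j.succ :=
    fun a b => Fin.sum_univ_succ _
  rcases le_or_gt (|r 0| * U) (|r J.succ| * δ) with hcase | hcase
  -- The two forms are $u_0$ and $r\cdot u$, so the minor is $r_J$; the bound 1 on the second forces
  -- $r\cdot u=0$.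
  · obtain ⟨z, hz0, hz1, hz2, hz3⟩ := exists_int_two_forms_lt P hP (Pi.single 0 1) r J hU one_pos hδ
      (by simpa using hJ0) (by simpa using hJU)
    set u := P.mulVec fun i => (z i : ℝ)
    rw [single_one_dotProduct] at hz1
    have h0 := hzero (hr z) hz2
    rw [hdot] at h0
    have hk2 : U ≤ k ^ 2 * U := le_mul_of_one_le_left hU.le (one_le_pow₀ hk1)
    refine ⟨z, hz0, hz1.le.trans hk2, fun j => ?_⟩
    by_cases hj : j = J
    · subst hj
      refine abs_le_of_sum_mul_eq (fun j => r j.succ) (fun j => u j.succ) j (e := -(r 0 * u 0))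
        hJ hJ0 (fun i hi => (hz3 i hi).le) ?_ (by linarith)
      rw [abs_neg, abs_mul]
      exact (mul_le_mul_of_nonneg_left hz1.le (abs_nonneg _)).trans hcase
    · exact (hz3 j hj).le.trans hδk
  · obtain ⟨s, hs, hD, j₀, hj₀⟩ := h2 hcase
    obtain ⟨I, -, hI⟩ := Finset.exists_max_image Finset.univ
      (fun j : Fin k => |r 0 * s j.succ - r j.succ * s 0|) ⟨J, Finset.mem_univ J⟩
    have hI0 : r 0 * s I.succ - r I.succ * s 0 ≠ 0 :=
      abs_pos.1 ((abs_pos.2 hj₀).trans_le (hI j₀ (Finset.mem_univ _)))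
    obtain ⟨z, hz0, hz1, hz2, hz3⟩ := exists_int_two_forms_lt P hP r s I one_pos one_pos hδ
      hI0 (by simpa using hD I)
    set u := P.mulVec fun i => (z i : ℝ)
    have h0 := hzero (hr z) hz1
    have h1 := hzero (hs z) hz2
    rw [hdot] at h0 h1
    have hu : ∀ j : Fin k, |u j.succ| ≤ k * δ := by
      intro j
      by_cases hj : j = I
      · subst hj
        -- Eliminating $u_0$ from $r\cdot u=0=s\cdot u$ leaves a relation among the other
        -- coordinates whose coefficients are the minors.
        refine abs_le_of_sum_mul_eq (fun j => r 0 * s j.succ - r j.succ * s 0)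
          (fun j => u j.succ) j (e := 0) (fun i => hI i (Finset.mem_univ i)) hI0
          (fun i hi => (hz3 i hi).le) (by rw [abs_zero]; positivity) ?_
        have : ∑ j : Fin k, (r 0 * s j.succ - r j.succ * s 0) * u j.succ =
            r 0 * ∑ j : Fin k, s j.succ * u j.succ - s 0 * ∑ j : Fin k, r j.succ * u j.succ := by
          rw [Finset.mul_sum, Finset.mul_sum, ← Finset.sum_sub_distrib]
          exact Finset.sum_congr rfl fun j _ => by ring
        rw [this]
        linear_combination r 0 * h1 - s 0 * h0
      · exact (hz3 j hj).le.trans hδk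
    refine ⟨z, hz0, ?_, hu⟩
    have hr0 : 0 < |r 0| := by
      by_contra! hneg
      have : 0 < |r 0| * U := lt_of_le_of_lt (by positivity) hcase
      nlinarith
    refine le_of_mul_le_mul_left ?_ hr0
    -- The coordinate $u_0$ is recovered from $r\cdot u=0$: $k$ terms, each at most
    -- $|r_J|\,k\delta$, whence $k^2$.
    calc |r 0| * |u 0| = |∑ j : Fin k, r j.succ * u j.succ| := by
          rw [← abs_mul, ← abs_neg]
          congr 1
          linarith
      _ ≤ ∑ j : Fin k, |r J.succ| * (k * δ) := by
          refine (Finset.abs_sum_le_sum_abs _ _).trans (Finset.sum_le_sum fun j _ => ?_)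
          rw [abs_mul]
          exact mul_le_mul (hJ j) (hu j) (abs_nonneg _) (abs_nonneg _)
      _ = k ^ 2 * (|r J.succ| * δ) := by
          rw [Finset.sum_const, Finset.card_univ, Fintype.card_fin, nsmul_eq_mul]
          ring
      _ ≤ k ^ 2 * (|r 0| * U) := by gcongr
      _ = |r 0| * (k ^ 2 * U) := by ring

/-! ### Solvability of the two systems and minimal points -/

/-- There is a nonzero integer point `z` with `|z_j| ≤ Q` for `j ≥ 1` and
`|z_0 + ∑ ξ_j z_j| ≤ Q ^ (-w)`. -/
def LinearFormSolvable {N : ℕ} (ξ : Fin N → ℝ) (w Q : ℝ) : Prop :=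
  ∃ z : Fin (N + 1) → ℤ, z ≠ 0 ∧ (∀ j : Fin N, |(z j.succ : ℝ)| ≤ Q) ∧
    |(z 0 : ℝ) + ∑ j : Fin N, ξ j * z j.succ| ≤ Q ^ (-w)

/-- Padding with zero coefficients leaves the form unchanged. This gives $\hat w_k\ge\hat w_n$, the
only passage from $n$ to $k$. -/
theorem LinearFormSolvable.initialEntries_mono {ξ : ℕ → ℝ} {w Q : ℝ} (hQ : 0 ≤ Q) {n k : ℕ}
    (hnk : n ≤ k) (h : LinearFormSolvable (initialEntries ξ n) w Q) :
    LinearFormSolvable (initialEntries ξ k) w Q := by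
  induction k, hnk using Nat.le_induction with
  | base => exact h
  | succ k _ ih =>
    obtain ⟨z, hz0, hz, hzw⟩ := ih
    have h0 : (Fin.snoc z 0 : Fin (k + 2) → ℤ) 0 = z 0 := by
      rw [← Fin.castSucc_zero, Fin.snoc_castSucc]
    have hsucc : ∀ j : Fin k, (Fin.snoc z 0 : Fin (k + 2) → ℤ) j.castSucc.succ = z j.succ := by
      intro j
      rw [Fin.succ_castSucc, Fin.snoc_castSucc]
    have hlast : (Fin.snoc z 0 : Fin (k + 2) → ℤ) (Fin.last k).succ = 0 := by
      rw [Fin.succ_last, Fin.snoc_last]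
    refine ⟨Fin.snoc z 0, fun h => hz0 ?_, fun j => ?_, ?_⟩
    · ext i
      have := congrFun h i.castSucc
      rwa [Fin.snoc_castSucc] at this
    · refine Fin.lastCases ?_ (fun j => ?_) j
      · rw [hlast]
        simpa
      · rw [hsucc]
        exact hz j
    · rw [Fin.sum_univ_castSucc, hlast, h0]
      simp only [hsucc]
      simpa [initialEntries] using hzw

theorem SimultaneouslySolvable.antitone {N : ℕ} {ξ : Fin N → ℝ} {l l' X : ℝ} (hX : 1 ≤ X)
    (hl : l ≤ l') (h : SimultaneouslySolvable ξ l' X) : SimultaneouslySolvable ξ l X := by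
  obtain ⟨x, y, h1, h2, h3⟩ := h
  exact ⟨x, y, h1, h2, fun j => (h3 j).trans
    (Real.rpow_le_rpow_of_exponent_le hX (neg_le_neg hl))⟩

/-- Minimality of $|x|$ at fixed quality later rules out proportional points of smaller height. -/
theorem SimultaneouslySolvable.exists_minimal {N : ℕ} {ξ : Fin N → ℝ} {l X : ℝ}
    (h : SimultaneouslySolvable ξ l X) :
    ∃ (x : ℤ) (y : Fin N → ℤ), 1 ≤ |(x : ℝ)| ∧ |(x : ℝ)| ≤ X ∧
      (∀ j, |ξ j * (x : ℝ) - (y j : ℝ)| ≤ X ^ (-l)) ∧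
      ∀ (x' : ℤ) (y' : Fin N → ℤ), 1 ≤ |(x' : ℝ)| → |(x' : ℝ)| < |(x : ℝ)| →
        ¬ ∀ j, |ξ j * (x' : ℝ) - (y' j : ℝ)| ≤ X ^ (-l) := by
  classical
  have hex : ∃ m : ℕ, ∃ (x : ℤ) (y : Fin N → ℤ), x.natAbs = m ∧ 1 ≤ |(x : ℝ)| ∧ |(x : ℝ)| ≤ X ∧
      ∀ j, |ξ j * (x : ℝ) - (y j : ℝ)| ≤ X ^ (-l) := by
    obtain ⟨x, y, h⟩ := h
    exact ⟨_, x, y, rfl, h⟩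
  obtain ⟨x, y, hm, h1, h2, h3⟩ := Nat.find_spec hex
  refine ⟨x, y, h1, h2, h3, fun x' y' h1' hlt h3' => ?_⟩
  have hmin := Nat.find_min' hex ⟨x', y', rfl, h1', hlt.le.trans h2, h3'⟩
  rw [← hm] at hmin
  have : ((x.natAbs : ℕ) : ℝ) ≤ x'.natAbs := by exact_mod_cast hmin
  rw [Nat.cast_natAbs, Nat.cast_natAbs, Int.cast_abs, Int.cast_abs] at this
  linarith

/-- Lets multiplicative constants be absorbed by an arbitrarily small loss in the exponent. -/
theorem eventually_mul_div_rpow_le {C a b : ℝ} (hC : 0 < C) (hab : a < b) :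
    ∀ᶠ Y : ℝ in atTop, C * (Y / C) ^ (-b) ≤ Y ^ (-a) := by
  filter_upwards [(tendsto_rpow_atTop (sub_pos.2 hab)).eventually_ge_atTop (C * C ^ b),
    eventually_gt_atTop 0] with Y hY hY0
  rw [Real.div_rpow hY0.le hC.le, Real.rpow_neg hC.le, div_inv_eq_mul]
  have h : Y ^ (-a) = Y ^ (-b) * Y ^ (b - a) := by
    rw [← Real.rpow_add hY0]
    congr 1
    ring
  rw [h]
  have := mul_le_mul_of_nonneg_left hY (Real.rpow_nonneg hY0.le (-b))
  linarith

/-! ### The upper bound one -/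

/-- The exponent of uniform approximation to an irrational number is at most one. -/
theorem le_one_of_eventually_simultaneouslySolvable {N : ℕ} {ξ : Fin N → ℝ} (i : Fin N)
    (hi : ∀ x y : ℤ, x ≠ 0 → ξ i * x - y ≠ 0) {l : ℝ}
    (h : ∀ᶠ X : ℝ in atTop, SimultaneouslySolvable ξ l X) : l ≤ 1 := by
  by_contra! hl
  have hl0 : 0 < l := one_pos.trans hl
  replace h : ∀ᶠ X : ℝ in atTop, SimultaneouslySolvable (fun _ : Fin 1 => ξ i) l X :=
    h.mono fun X ⟨x, y, h1, h2, h3⟩ => ⟨x, fun _ => y i, h1, h2, fun _ => h3 i⟩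
  obtain ⟨X₀, hX₀⟩ := eventually_atTop.1 h
  have hev : ∀ᶠ X : ℝ in atTop, 3 ≤ X ^ (l - 1) :=
    (tendsto_rpow_atTop (sub_pos.2 hl)).eventually_ge_atTop 3
  obtain ⟨X, hXl, hXX₀, hX1⟩ :=
    (hev.and ((eventually_ge_atTop X₀).and (eventually_ge_atTop 1))).exists
  have hX0 : 0 < X := one_pos.trans_le hX1
  obtain ⟨x, y, hx1, hxX, hL, hmin⟩ := (hX₀ X hXX₀).exists_minimal
  have hx0 : x ≠ 0 := by
    rintro rfl
    norm_num at hx1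
  have hE := abs_pos.2 (hi x (y 0) hx0)
  set E := |ξ i * x - y 0| with hEdef
  have hEX : E ≤ X ^ (-l) := hL 0
  have he : 0 < E / 2 := half_pos hE
  -- The height $Y=(E/2)^{-1/l}$ satisfies $Y^{-l}=E/2$. The point found there has determinant with
  -- $(x,y)$ at most $\tfrac52X^{1-l}\le\tfrac56$, hence zero; being proportional with at most half
  -- the error, it contradicts minimality of $|x|$.
  have hY : X ≤ (E / 2) ^ (-(1 / l)) := by
    have h1 : (X ^ (-l)) ^ (-(1 / l)) = X := by
      rw [← Real.rpow_mul hX0.le, show -l * -(1 / l) = 1 by field_simp, Real.rpow_one]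
    rw [← h1]
    exact Real.rpow_le_rpow_of_nonpos he (by linarith) (by simp [hl0.le])
  obtain ⟨x', y', hx1', hxY, hL'⟩ := hX₀ _ (hXX₀.trans hY)
  have hYl : ((E / 2) ^ (-(1 / l))) ^ (-l) = E / 2 := by
    rw [← Real.rpow_mul he.le, show -(1 / l) * -l = 1 by field_simp, Real.rpow_one]
  have hE' : |ξ i * x' - y' 0| ≤ E / 2 := (hL' 0).trans_eq hYl
  have hsmall : X * X ^ (-l) ≤ 1 / 3 := by
    have : X * X ^ (-l) = (X ^ (l - 1))⁻¹ := by
      rw [← Real.rpow_neg hX0.le, ← Real.rpow_one_add' hX0.le (by linarith)]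
      congr 1
      ring
    rw [this, one_div]
    exact inv_anti₀ (by norm_num) hXl
  have heY : (E / 2) * (E / 2) ^ (-(1 / l)) ≤ X * X ^ (-l) := by
    have h1 : 0 ≤ 1 - 1 / l := by
      rw [sub_nonneg, div_le_one hl0]
      exact hl.le
    have h2 : (E / 2) * (E / 2) ^ (-(1 / l)) = (E / 2) ^ (1 - 1 / l) := by
      rw [sub_eq_add_neg, Real.rpow_add he, Real.rpow_one]
    have h3 : X * X ^ (-l) = (X ^ (-l)) ^ (1 - 1 / l) := by
      rw [← Real.rpow_mul hX0.le, show -l * (1 - 1 / l) = 1 + -l by field_simp; ring,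
        Real.rpow_add hX0, Real.rpow_one]
    rw [h2, h3]
    exact Real.rpow_le_rpow he.le (by linarith) h1
  have hD : ((x' * y 0 - x * y' 0 : ℤ) : ℝ) =
      x * (ξ i * x' - y' 0) - x' * (ξ i * x - y 0) := by
    push_cast
    ring
  have hDlt : |((x' * y 0 - x * y' 0 : ℤ) : ℝ)| < 1 := by
    rw [hD]
    calc _ ≤ |(x : ℝ) * (ξ i * x' - y' 0)| + |(x' : ℝ) * (ξ i * x - y 0)| := abs_sub _ _
      _ = |(x : ℝ)| * |ξ i * x' - y' 0| + |(x' : ℝ)| * E := by rw [abs_mul, abs_mul]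
      _ ≤ X * (E / 2) + (E / 2) ^ (-(1 / l)) * E := by gcongr
      _ ≤ X * X ^ (-l) / 2 + 2 * (X * X ^ (-l)) := by
          have : X * E ≤ X * X ^ (-l) := by gcongr
          linarith
      _ < 1 := by linarith
  have hD0 : x' * y 0 - x * y' 0 = 0 := Int.abs_lt_one_iff.1 (by exact_mod_cast hDlt)
  rw [hD0, Int.cast_zero] at hD
  have hx'lt : |(x' : ℝ)| < |(x : ℝ)| := by
    have h1 : |(x' : ℝ)| * E = |(x : ℝ)| * |ξ i * x' - y' 0| := by
      rw [hEdef, ← abs_mul, ← abs_mul]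
      congr 1
      linarith
    have h2 : |(x' : ℝ)| * E ≤ |(x : ℝ)| * (E / 2) := by
      rw [h1]
      gcongr
    have h3 : |(x : ℝ)| * (E / 2) < |(x : ℝ)| * E :=
      mul_lt_mul_of_pos_left (by linarith) (by linarith)
    exact lt_of_mul_lt_mul_right (h2.trans_lt h3) hE.le
  refine hmin x' y' hx1' hx'lt fun j => ?_
  rw [Subsingleton.elim j 0]
  linarith

/-! ### The two lattices, dual to each other up to signs -/

/-- The matrix of the linear form `z_0 + ∑ ξ_j z_j` and the coordinates `z_j`. -/
def linearFormMatrix {N : ℕ} (ξ : Fin N → ℝ) : Matrix (Fin (N + 1)) (Fin (N + 1)) ℝ :=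
  Matrix.of (Fin.cons (Fin.cons 1 ξ) fun j => Pi.single j.succ 1)

theorem linearFormMatrix_mulVec_zero {N : ℕ} (ξ : Fin N → ℝ) (v : Fin (N + 1) → ℝ) :
    (linearFormMatrix ξ).mulVec v 0 = v 0 + ∑ j : Fin N, ξ j * v j.succ := by
  simp [linearFormMatrix, Matrix.mulVec, dotProduct, Fin.sum_univ_succ]

theorem linearFormMatrix_mulVec_succ {N : ℕ} (ξ : Fin N → ℝ) (v : Fin (N + 1) → ℝ) (j : Fin N) :
    (linearFormMatrix ξ).mulVec v j.succ = v j.succ := by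
  simp [linearFormMatrix, Matrix.mulVec]

theorem linearFormMatrix_det {N : ℕ} (ξ : Fin N → ℝ) : (linearFormMatrix ξ).det = 1 := by
  have : (linearFormMatrix ξ).submatrix (Fin.succAbove 0) Fin.succ = 1 := by
    ext i j
    simp [linearFormMatrix, Matrix.one_apply, Pi.single_apply, eq_comm]
  rw [Matrix.det_succ_column_zero, Fin.sum_univ_succ, this]
  simp [linearFormMatrix]

/-- The matrix of the coordinate `z_0` and the linear forms `ξ_j z_0 - z_j`. -/
def simultaneousMatrix {N : ℕ} (ξ : Fin N → ℝ) : Matrix (Fin (N + 1)) (Fin (N + 1)) ℝ :=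
  Matrix.of (Fin.cons (Pi.single 0 1) fun j => Fin.cons (ξ j) (-Pi.single j 1))

theorem simultaneousMatrix_mulVec_zero {N : ℕ} (ξ : Fin N → ℝ) (v : Fin (N + 1) → ℝ) :
    (simultaneousMatrix ξ).mulVec v 0 = v 0 := by
  simp [simultaneousMatrix, Matrix.mulVec]

theorem simultaneousMatrix_mulVec_succ {N : ℕ} (ξ : Fin N → ℝ) (v : Fin (N + 1) → ℝ)
    (j : Fin N) : (simultaneousMatrix ξ).mulVec v j.succ = ξ j * v 0 - v j.succ := by
  simp [simultaneousMatrix, Matrix.mulVec, dotProduct, Fin.sum_univ_succ, Pi.single_apply,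
    sub_eq_add_neg]

theorem abs_simultaneousMatrix_det {N : ℕ} (ξ : Fin N → ℝ) :
    |(simultaneousMatrix ξ).det| = 1 := by
  have : (simultaneousMatrix ξ).submatrix Fin.succ (Fin.succAbove 0) = -1 := by
    ext i j
    simp [simultaneousMatrix, Matrix.one_apply, Pi.single_apply, eq_comm]
  rw [Matrix.det_succ_row_zero, Fin.sum_univ_succ, this]
  simp [simultaneousMatrix, Matrix.det_neg]

/-! ### From simultaneous approximation to the linear form -/

/-- Uniform simultaneous approximations give small values of the linear form. -/
theorem exists_linearForm_of_simultaneouslySolvable {n : ℕ} (hn : 2 ≤ n) {ξ : Fin n → ℝ}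
    (hξ : ∀ (x : ℤ) (y : Fin n → ℤ), x ≠ 0 → ∃ j, ξ j * x - y j ≠ 0) {l w : ℝ} (hl0 : 0 ≤ l)
    (hl1 : l < 1) (hw : 0 < w) (hwl : w * (1 - l) = n - 1)
    (h : ∀ᶠ X : ℝ in atTop, SimultaneouslySolvable ξ l X) :
    ∀ᶠ Q : ℝ in atTop, ∃ z : Fin (n + 1) → ℤ, z ≠ 0 ∧
      (∀ j : Fin n, |(z j.succ : ℝ)| ≤ 4 * n ^ 2 * Q) ∧
      |(z 0 : ℝ) + ∑ j : Fin n, ξ j * z j.succ| ≤ 4 * n ^ 2 * Q ^ (-w) := by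
  obtain ⟨X₀, hX₀⟩ := eventually_atTop.1 h
  filter_upwards [eventually_ge_atTop X₀, eventually_ge_atTop 1,
    (tendsto_rpow_atTop hw).eventually_ge_atTop X₀] with Q hQX hQ1 hT
  have hQ0 : 0 < Q := one_pos.trans_le hQ1
  have hn1 : (1 : ℝ) ≤ n := by exact_mod_cast (by lia : 1 ≤ n)
  -- The approximations are taken up to height $T=Q^w$, so that the minors, of order $T^{1-l}$,
  -- match $Q^{n-1}$.
  have hqT : (Q ^ w) ^ (1 - l) = Q ^ (n - 1) := by
    rw [← Real.rpow_mul hQ0.le, hwl, ← Real.rpow_natCast, Nat.cast_sub (by lia), Nat.cast_one]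
  rw [Real.rpow_neg hQ0.le]
  set T := Q ^ w with hTdef
  set q := Q ^ (n - 1) with hqdef
  have hT0 : 0 < T := Real.rpow_pos_of_pos hQ0 _
  have hq0 : 0 < q := pow_pos hQ0 _
  have hTl : T ^ (-l) = q * T⁻¹ := by
    rw [← hqT, ← Real.rpow_neg_one, ← Real.rpow_add hT0]
    congr 1
    ring
  -- Taking $\delta=4Q$ absorbs the factor $5/2$ in the minor bound, since $4^{n-1}\ge4$.
  have hq : 4 * q ≤ (4 * Q) ^ (n - 1) := by
    rw [mul_pow]
    gcongr
    exact le_self_pow₀ (by norm_num) (by lia)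
  have hδ1 : 1 ≤ (4 * Q) ^ (n - 1) := one_le_pow₀ (by linarith)
  obtain ⟨x, y, hx1, hxT, hL, hmin⟩ := (hX₀ T hT).exists_minimal
  have hx0 : 0 < |(x : ℝ)| := one_pos.trans_le hx1
  have hxne : x ≠ 0 := by
    rintro rfl
    simp at hx0
  obtain ⟨j₀, hj₀⟩ := hξ x y hxne
  obtain ⟨J, -, hJ⟩ := Finset.exists_max_image Finset.univ
    (fun j => |ξ j * x - y j|) ⟨j₀, Finset.mem_univ j₀⟩
  have hJ0 : 0 < |ξ J * x - y J| := (abs_pos.2 hj₀).trans_le (hJ j₀ (Finset.mem_univ _))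
  have hint : ∀ (x : ℤ) (y : Fin n → ℤ) (z : Fin (n + 1) → ℤ), ∃ m : ℤ,
      ((Fin.cons (x : ℝ) fun j => -(ξ j * x - y j) : Fin (n + 1) → ℝ) ⬝ᵥ
        (linearFormMatrix ξ).mulVec fun i => (z i : ℝ)) = m := by
    intro x y z
    refine ⟨x * z 0 + ∑ j : Fin n, y j * z j.succ, ?_⟩
    simp only [dotProduct, Fin.sum_univ_succ, Fin.cons_zero, Fin.cons_succ,
      linearFormMatrix_mulVec_zero, linearFormMatrix_mulVec_succ]
    push_cast
    rw [mul_add, add_assoc, Finset.mul_sum, ← Finset.sum_add_distrib]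
    congr 1
    exact Finset.sum_congr rfl fun j _ => by ring
  obtain ⟨z, hz0, hz1, hz2⟩ := exists_int_ne_zero_of_dual (linearFormMatrix ξ)
    (by rw [linearFormMatrix_det, abs_one]) (Fin.cons (x : ℝ) fun j => -(ξ j * x - y j))
    (hint x y) (U := 2 * |ξ J * x - y J| / (4 * Q) ^ (n - 1)) (δ := 4 * Q) (by positivity)
    (by positivity) J
    (by simpa only [Fin.cons_succ, abs_neg] using fun j => hJ j (Finset.mem_univ j))
    (by simpa only [Fin.cons_succ, neg_ne_zero] using abs_pos.1 hJ0)
    (by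
      rw [Fin.cons_succ, abs_neg, div_mul_cancel₀ _ (by positivity)]
      linarith)
    (by
      simp only [Fin.cons_succ, Fin.cons_zero, abs_neg]
      intro hcase
      -- The case condition makes $|x|/2$ exceed $Q\ge X_0$, so uniformity applies there; halving
      -- also ensures $|x'|<|x|$.
      have hxQ : 2 * Q < |(x : ℝ)| := by
        have h1 : |(x : ℝ)| * (2 * |ξ J * x - y J| / (4 * Q) ^ (n - 1)) ≤
            |(x : ℝ)| * (2 * |ξ J * x - y J|) := by
          gcongr
          exact div_le_self (by positivity) hδ1
        have h2 : |ξ J * x - y J| * (4 * Q) < |ξ J * x - y J| * (2 * |(x : ℝ)|) := by linarith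
        linarith [lt_of_mul_lt_mul_left h2 hJ0.le]
      obtain ⟨x', y', hx1', hxx', hL'⟩ := hX₀ (|(x : ℝ)| / 2) (by linarith)
      refine ⟨Fin.cons (x' : ℝ) fun j => -(ξ j * x' - y' j), hint x' y', fun j => ?_, ?_⟩
      · simp only [Fin.cons_succ, Fin.cons_zero]
        have h1 : (|(x : ℝ)| / 2) ^ (-l) ≤ 2 * |(x : ℝ)| ^ (-l) := by
          rw [Real.div_rpow hx0.le (by norm_num), Real.rpow_neg (by norm_num : (0 : ℝ) ≤ 2),
            div_inv_eq_mul, mul_comm]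
          gcongr
          calc (2 : ℝ) ^ l ≤ 2 ^ (1 : ℝ) :=
                Real.rpow_le_rpow_of_exponent_le (by norm_num) hl1.le
            _ = 2 := Real.rpow_one 2
        have h2 : T ^ (-l) ≤ |(x : ℝ)| ^ (-l) :=
          Real.rpow_le_rpow_of_nonpos hx0 hxT (by linarith)
        have h3 : |(x : ℝ)| * |(x : ℝ)| ^ (-l) ≤ q := by
          rw [← hqT, ← Real.rpow_one_add' hx0.le (by linarith), ← sub_eq_add_neg]
          exact Real.rpow_le_rpow hx0.le hxT (by linarith)
        calc _ = |(-((x : ℝ) * (ξ j * x' - y' j))) + (ξ j * x - y j) * x'| := by congr 1; ring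
          _ ≤ |(x : ℝ)| * |ξ j * x' - y' j| + |ξ j * x - y j| * |(x' : ℝ)| := by
              refine (abs_add_le _ _).trans_eq ?_
              rw [abs_neg, abs_mul, abs_mul]
          _ ≤ |(x : ℝ)| * (2 * |(x : ℝ)| ^ (-l)) + |(x : ℝ)| ^ (-l) * (|(x : ℝ)| / 2) := by
              gcongr
              · exact (hL' j).trans h1
              · exact (hL j).trans h2
          _ < 4 * q := by linarith
          _ ≤ _ := hq
      -- If all minors vanish, the errors of $x'$ are those of $x$ scaled by $|x'|/|x|<1$, against
      -- minimality.
      · by_contra! hall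
        simp only [Fin.cons_succ, Fin.cons_zero] at hall
        refine hmin x' y' hx1' (by linarith) fun j => ?_
        have h1 : |(x : ℝ)| * |ξ j * x' - y' j| = |(x' : ℝ)| * |ξ j * x - y j| := by
          rw [← abs_mul, ← abs_mul]
          congr 1
          linarith [hall j]
        have h2 : |(x : ℝ)| * |ξ j * x' - y' j| ≤ |(x : ℝ)| * |ξ j * x - y j| := by
          rw [h1]
          exact mul_le_mul_of_nonneg_right (by linarith) (abs_nonneg _)
        exact (le_of_mul_le_mul_left h2 hx0).trans (hL j))
  simp only [linearFormMatrix_mulVec_zero, linearFormMatrix_mulVec_succ] at hz1 hz2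
  refine ⟨z, hz0, fun j => (hz2 j).trans ?_, hz1.trans ?_⟩
  · have : (n : ℝ) ≤ n ^ 2 := le_self_pow₀ hn1 (by norm_num)
    nlinarith
  · have h1 : 2 * |ξ J * x - y J| / (4 * Q) ^ (n - 1) ≤ T⁻¹ := by
      calc _ ≤ 2 * (q * T⁻¹) / (4 * q) := by
            gcongr
            exact (hL J).trans_eq hTl
        _ = T⁻¹ / 2 := by field_simp; norm_num
        _ ≤ T⁻¹ := half_le_self (by positivity)
    calc _ ≤ (n : ℝ) ^ 2 * T⁻¹ := by gcongr
      _ ≤ 4 * n ^ 2 * T⁻¹ := by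
        have : 0 ≤ (n : ℝ) ^ 2 * T⁻¹ := by positivity
        linarith

/-! ### From the linear form to simultaneous approximation -/

/-- The form bounds $z_0$ once the other coordinates are bounded. Finiteness provides a point
minimizing the value of the form. -/
theorem finite_setOf_linearForm_le {N : ℕ} (ξ : Fin N → ℝ) (Q B : ℝ) :
    {z : Fin (N + 1) → ℤ | (∀ j : Fin N, |(z j.succ : ℝ)| ≤ Q) ∧
      |(z 0 : ℝ) + ∑ j : Fin N, ξ j * z j.succ| ≤ B}.Finite := by
  set M : ℤ := ⌈B + ∑ j : Fin N, |ξ j| * Q⌉ with hM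
  refine (Set.finite_Icc (Fin.cons (-M) fun _ => -⌈Q⌉) (Fin.cons M fun _ => ⌈Q⌉)).subset ?_
  rintro z ⟨hz, hzB⟩
  have key : ∀ (a : ℤ) (b : ℝ), |(a : ℝ)| ≤ b → -⌈b⌉ ≤ a ∧ a ≤ ⌈b⌉ := by
    intro a b hab
    have : |(a : ℝ)| ≤ (⌈b⌉ : ℝ) := hab.trans (Int.le_ceil b)
    rw [abs_le] at this
    exact_mod_cast this
  have h0 : |(z 0 : ℝ)| ≤ B + ∑ j : Fin N, |ξ j| * Q := by
    have h1 : |∑ j : Fin N, ξ j * z j.succ| ≤ ∑ j : Fin N, |ξ j| * Q := by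
      refine (Finset.abs_sum_le_sum_abs _ _).trans (Finset.sum_le_sum fun j _ => ?_)
      rw [abs_mul]
      exact mul_le_mul_of_nonneg_left (hz j) (abs_nonneg _)
    have h2 := abs_sub ((z 0 : ℝ) + ∑ j : Fin N, ξ j * z j.succ) (∑ j : Fin N, ξ j * z j.succ)
    rw [add_sub_cancel_right] at h2
    linarith
  refine ⟨fun i => ?_, fun i => ?_⟩
  · refine Fin.cases ?_ (fun j => ?_) i
    · exact (key _ _ h0).1
    · exact (key _ _ (hz j)).1
  · refine Fin.cases ?_ (fun j => ?_) i
    · exact (key _ _ h0).2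
    · exact (key _ _ (hz j)).2

/-- Uniformly small values of the linear form give simultaneous approximations. -/
theorem exists_simultaneous_of_linearFormSolvable {k : ℕ} (hk : 2 ≤ k) {ξ : Fin k → ℝ}
    (hξ : ∀ z : Fin (k + 1) → ℤ, z ≠ 0 → (z 0 : ℝ) + ∑ j : Fin k, ξ j * z j.succ ≠ 0) {w μ : ℝ}
    (hw : 1 < w) (hwμ : μ * (k - 1) = 1 - 1 / w)
    (h : ∀ᶠ Q : ℝ in atTop, LinearFormSolvable ξ w Q) :
    ∀ᶠ X : ℝ in atTop, ∃ z : Fin (k + 1) → ℤ, z ≠ 0 ∧ |(z 0 : ℝ)| ≤ 4 * k ^ 2 * X ∧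
      ∀ j : Fin k, |ξ j * z 0 - z j.succ| ≤ 4 * k ^ 2 * X ^ (-μ) := by
  have hw0 : 0 < w := one_pos.trans hw
  obtain ⟨Q₀, hQ₀⟩ := eventually_atTop.1 h
  filter_upwards [eventually_gt_atTop 1,
    (tendsto_rpow_atTop (one_div_pos.2 hw0)).eventually_ge_atTop Q₀] with X hX1 hQQ₀
  have hX0 : 0 < X := one_pos.trans hX1
  have hk1 : (1 : ℝ) ≤ k := by exact_mod_cast (by lia : 1 ≤ k)
  -- With $Q=X^{1/w}$ the form is at most $1/X$, and $m=X^{-\mu}$ satisfies $m^{k-1}=Q/X$, the order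
  -- of the minors.
  have hQw : (X ^ (1 / w)) ^ (-w) = X⁻¹ := by
    rw [← Real.rpow_mul hX0.le, show 1 / w * -w = -1 by field_simp, Real.rpow_neg_one]
  have hXinv : X⁻¹ ^ (1 - 1 / w) = X ^ (1 / w) * X⁻¹ := by
    rw [← Real.rpow_neg_one, ← Real.rpow_mul hX0.le, ← Real.rpow_add hX0]
    congr 1
    ring
  have hm : (X ^ (-μ)) ^ (k - 1) = X ^ (1 / w) * X⁻¹ := by
    rw [← hXinv, ← Real.rpow_neg_one, ← Real.rpow_mul hX0.le, ← hwμ, ← Real.rpow_natCast,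
      ← Real.rpow_mul hX0.le, Nat.cast_sub (by lia), Nat.cast_one]
    congr 1
    ring
  set m := X ^ (-μ) with hmdef
  set Q := X ^ (1 / w) with hQdef
  have hm0 : 0 < m := Real.rpow_pos_of_pos hX0 _
  have hQ0 : 0 < Q := Real.rpow_pos_of_pos hX0 _
  have hδ : 4 * (Q * X⁻¹) ≤ (4 * m) ^ (k - 1) := by
    rw [mul_pow, hm]
    gcongr
    exact le_self_pow₀ (by norm_num) (by lia)
  obtain ⟨a, ⟨ha0, haQ, haX⟩, hmin⟩ := Set.exists_min_image
    {z : Fin (k + 1) → ℤ | z ≠ 0 ∧ (∀ j : Fin k, |(z j.succ : ℝ)| ≤ Q) ∧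
      |(z 0 : ℝ) + ∑ j : Fin k, ξ j * z j.succ| ≤ X⁻¹}
    (fun z => |(z 0 : ℝ) + ∑ j : Fin k, ξ j * z j.succ|)
    ((finite_setOf_linearForm_le ξ Q X⁻¹).subset fun z hz => hz.2)
    (by
      obtain ⟨z, hz0, hz, hzw⟩ := hQ₀ Q hQQ₀
      exact ⟨z, hz0, hz, hzw.trans_eq hQw⟩)
  have hE := abs_pos.2 (hξ a ha0)
  set E := (a 0 : ℝ) + ∑ j : Fin k, ξ j * a j.succ with hEdef
  -- Otherwise the form is the integer $a_0$, of absolute value at most $1/X<1$, so $a=0$.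
  obtain ⟨j₀, hj₀⟩ : ∃ j : Fin k, a j.succ ≠ 0 := by
    by_contra! hall
    have hEa : E = a 0 := by simp [hEdef, hall]
    have : |(a 0 : ℝ)| < 1 := by
      rw [← hEa]
      exact haX.trans_lt (inv_lt_one_of_one_lt₀ hX1)
    have ha00 : a 0 = 0 := Int.abs_lt_one_iff.1 (by exact_mod_cast this)
    exact ha0 (funext fun i => Fin.cases ha00 hall i)
  obtain ⟨J, -, hJ⟩ := Finset.exists_max_image Finset.univ
    (fun j : Fin k => |(a j.succ : ℝ)|) ⟨j₀, Finset.mem_univ j₀⟩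
  have hJ0 : 0 < |(a J.succ : ℝ)| :=
    (abs_pos.2 (Int.cast_ne_zero.2 hj₀)).trans_le (hJ j₀ (Finset.mem_univ _))
  have hint : ∀ a z : Fin (k + 1) → ℤ, ∃ m : ℤ,
      ((Fin.cons ((a 0 : ℝ) + ∑ j : Fin k, ξ j * a j.succ) fun j => -(a j.succ : ℝ) :
        Fin (k + 1) → ℝ) ⬝ᵥ (simultaneousMatrix ξ).mulVec fun i => (z i : ℝ)) = m := by
    intro a z
    refine ⟨a 0 * z 0 + ∑ j : Fin k, a j.succ * z j.succ, ?_⟩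
    simp only [dotProduct, Fin.sum_univ_succ, Fin.cons_zero, Fin.cons_succ,
      simultaneousMatrix_mulVec_zero, simultaneousMatrix_mulVec_succ]
    push_cast
    rw [add_mul, add_assoc, Finset.sum_mul, ← Finset.sum_add_distrib]
    congr 1
    exact Finset.sum_congr rfl fun j _ => by ring
  obtain ⟨z, hz0, hz1, hz2⟩ := exists_int_ne_zero_of_dual (simultaneousMatrix ξ)
    (abs_simultaneousMatrix_det ξ) (Fin.cons E fun j => -(a j.succ : ℝ))
    (hint a) hX0 (δ := 4 * m) (by positivity) J
    (by simpa only [Fin.cons_succ, abs_neg] using fun j => hJ j (Finset.mem_univ j))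
    (by simpa only [Fin.cons_succ, neg_ne_zero] using abs_pos.1 hJ0)
    (by
      rw [Fin.cons_succ, abs_neg]
      calc |(a J.succ : ℝ)| ≤ Q := haQ J
        _ < 4 * Q := by linarith
        _ = X * (4 * (Q * X⁻¹)) := by field_simp
        _ ≤ _ := by gcongr)
    (by
      intro _
      have he : 0 < |E| / 2 := half_pos hE
      have heX : |E| / 2 ≤ X⁻¹ := by linarith
      -- At height $Q'=(|E|/2)^{-1/w}$ uniformity gives a value at most $|E|/2$. The minors are at
      -- most $3Q'|E|/2\le3Q/X$, because $t^{1-1/w}$ increases for $w>1$.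
      have hQ' : Q ≤ (|E| / 2) ^ (-(1 / w)) := by
        have h1 : X⁻¹ ^ (-(1 / w)) = Q := by
          rw [Real.inv_rpow hX0.le, Real.rpow_neg hX0.le, inv_inv]
        rw [← h1]
        exact Real.rpow_le_rpow_of_nonpos he heX (by simp [hw0.le])
      obtain ⟨b, hb0, hbQ, hbE⟩ := hQ₀ _ (hQQ₀.trans hQ')
      rw [← Real.rpow_mul he.le, show -(1 / w) * -w = 1 by field_simp, Real.rpow_one] at hbE
      have heQ : (|E| / 2) * (|E| / 2) ^ (-(1 / w)) ≤ Q * X⁻¹ := by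
        rw [← hXinv, ← Real.rpow_one_add' he.le, ← sub_eq_add_neg]
        · refine Real.rpow_le_rpow he.le heX ?_
          rw [sub_nonneg, div_le_one hw0]
          exact hw.le
        · rw [← sub_eq_add_neg, sub_ne_zero]
          exact ((div_lt_one hw0).2 hw).ne'
      set Q' := (|E| / 2) ^ (-(1 / w)) with hQ'def
      refine ⟨Fin.cons ((b 0 : ℝ) + ∑ j : Fin k, ξ j * b j.succ) fun j => -(b j.succ : ℝ),
        hint b, fun j => ?_, ?_⟩
      · simp only [Fin.cons_succ, Fin.cons_zero]
        calc _ ≤ |E| * |(b j.succ : ℝ)| +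
              |(a j.succ : ℝ)| * |(b 0 : ℝ) + ∑ j : Fin k, ξ j * b j.succ| := by
              refine (abs_sub _ _).trans_eq ?_
              rw [abs_mul, abs_mul, abs_neg, abs_neg]
          _ ≤ |E| * Q' + Q' * (|E| / 2) := by
              gcongr
              · exact hbQ j
              · exact (haQ j).trans hQ'
          _ < 4 * (Q * X⁻¹) := by
              have : 0 < |E| / 2 * Q' := by
                have := hQ0.trans_le hQ'
                positivity
              linarith
          _ ≤ _ := hδ
      -- A proportional $b$ would inherit the height bound $Q$ and have a smaller value than the
      -- minimum $|E|$.
      · by_contra! hall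
        simp only [Fin.cons_succ, Fin.cons_zero] at hall
        have hb : b ∈ {z : Fin (k + 1) → ℤ | z ≠ 0 ∧ (∀ j : Fin k, |(z j.succ : ℝ)| ≤ Q) ∧
            |(z 0 : ℝ) + ∑ j : Fin k, ξ j * z j.succ| ≤ X⁻¹} := by
          refine ⟨hb0, fun j => ?_, by linarith⟩
          have h1 : |E| * |(b j.succ : ℝ)| =
              |(a j.succ : ℝ)| * |(b 0 : ℝ) + ∑ j : Fin k, ξ j * b j.succ| := by
            rw [← abs_mul, ← abs_mul]
            congr 1
            linarith [hall j]
          have h2 : |E| * |(b j.succ : ℝ)| ≤ |E| * Q := by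
            rw [h1, mul_comm |E|]
            exact mul_le_mul (haQ j) (by linarith) (abs_nonneg _) hQ0.le
          exact le_of_mul_le_mul_left h2 hE
        have := hmin b hb
        linarith)
  simp only [simultaneousMatrix_mulVec_zero, simultaneousMatrix_mulVec_succ] at hz1 hz2
  refine ⟨z, hz0, hz1.trans ?_, fun j => (hz2 j).trans ?_⟩
  · have : 0 ≤ (k : ℝ) ^ 2 * X := by positivity
    linarith
  · have : (k : ℝ) ≤ k ^ 2 := le_self_pow₀ hk1 (by norm_num)
    nlinarith

/-! ### Transference without constants -/

theorem eventually_linearFormSolvable_of_simultaneouslySolvable {n : ℕ} (hn : 2 ≤ n)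
    {ξ : Fin n → ℝ} (hξ : ∀ (x : ℤ) (y : Fin n → ℤ), x ≠ 0 → ∃ j, ξ j * x - y j ≠ 0)
    {l w : ℝ} (hl0 : 0 ≤ l) (hl1 : l < 1) (hwl : w * (1 - l) < n - 1)
    (h : ∀ᶠ X : ℝ in atTop, SimultaneouslySolvable ξ l X) :
    ∀ᶠ Q : ℝ in atTop, LinearFormSolvable ξ w Q := by
  have hn0 : (2 : ℝ) ≤ n := by exact_mod_cast hn
  have hl : 0 < 1 - l := sub_pos.2 hl1
  have hC : (0 : ℝ) < 4 * n ^ 2 := by positivity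
  filter_upwards [(tendsto_id.atTop_div_const hC).eventually
      (exists_linearForm_of_simultaneouslySolvable hn hξ hl0 hl1
        (w := (n - 1) / (1 - l)) (div_pos (by linarith) hl) (div_mul_cancel₀ _ hl.ne') h),
    eventually_mul_div_rpow_le hC ((lt_div_iff₀ hl).2 hwl)] with Q ⟨z, hz0, hz, hzw⟩ hQ
  exact ⟨z, hz0, fun j => (hz j).trans_eq (mul_div_cancel₀ _ hC.ne'), hzw.trans hQ⟩

theorem eventually_simultaneouslySolvable_of_linearFormSolvable {k : ℕ} (hk : 2 ≤ k)
    {ξ : Fin k → ℝ}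
    (hξ : ∀ z : Fin (k + 1) → ℤ, z ≠ 0 → (z 0 : ℝ) + ∑ j : Fin k, ξ j * z j.succ ≠ 0) {w μ : ℝ}
    (hw : 1 < w) (hμ : 0 < μ) (hwμ : μ * (k - 1) < 1 - 1 / w)
    (h : ∀ᶠ Q : ℝ in atTop, LinearFormSolvable ξ w Q) :
    ∀ᶠ X : ℝ in atTop, SimultaneouslySolvable ξ μ X := by
  have hk0 : (2 : ℝ) ≤ k := by exact_mod_cast hk
  have hk1 : (0 : ℝ) < k - 1 := by linarith
  have hC : (0 : ℝ) < 4 * k ^ 2 := by positivity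
  filter_upwards [(tendsto_id.atTop_div_const hC).eventually
      (exists_simultaneous_of_linearFormSolvable hk hξ hw
        (μ := (1 - 1 / w) / (k - 1)) (div_mul_cancel₀ _ hk1.ne') h),
    eventually_mul_div_rpow_le hC ((lt_div_iff₀ hk1).2 hwμ),
    eventually_gt_atTop 1] with X ⟨z, hz0, hz, hzw⟩ hX hX1
  have hsmall : ∀ j : Fin k, |ξ j * z 0 - z j.succ| ≤ X ^ (-μ) := fun j => (hzw j).trans hX
  refine ⟨z 0, fun j => z j.succ, ?_, hz.trans_eq (mul_div_cancel₀ _ hC.ne'), hsmall⟩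
  -- With $z_0=0$ the remaining integers would be at most $X^{-\mu}<1$ in absolute value, so $z=0$.
  have hz00 : z 0 ≠ 0 := by
    intro h0
    refine hz0 (funext fun i => Fin.cases h0 (fun j => ?_) i)
    have h1 := (hsmall j).trans_lt (Real.rpow_lt_one_of_one_lt_of_neg hX1 (neg_lt_zero.2 hμ))
    rw [h0, Int.cast_zero, mul_zero, zero_sub, abs_neg] at h1
    exact Int.abs_lt_one_iff.1 (by exact_mod_cast h1)
  exact_mod_cast Int.one_le_abs hz00

/-! ### Linear independence, exponents and the conclusion -/

theorem LinearIndependent.int_linearForm_ne_zero {N : ℕ} {ξ : Fin N → ℝ}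
    (h : LinearIndependent ℚ (Fin.cons 1 ξ : Fin (N + 1) → ℝ)) (z : Fin (N + 1) → ℤ)
    (hz : z ≠ 0) : (z 0 : ℝ) + ∑ j : Fin N, ξ j * z j.succ ≠ 0 := by
  intro h0
  refine hz (funext fun i => ?_)
  have := Fintype.linearIndependent_iff.1 h (fun i => (z i : ℚ)) (by
    rw [Fin.sum_univ_succ]
    simpa [Rat.smul_def, mul_comm] using h0) i
  exact_mod_cast this

theorem LinearIndependent.int_mul_sub_ne_zero {N : ℕ} {ξ : Fin N → ℝ}
    (h : LinearIndependent ℚ (Fin.cons 1 ξ : Fin (N + 1) → ℝ)) (i : Fin N) {x : ℤ} (hx : x ≠ 0)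
    (y : ℤ) : ξ i * x - y ≠ 0 := by
  classical
  have := h.int_linearForm_ne_zero (Fin.cons (-y) (Pi.single i x)) (fun h0 => hx (by
    simpa using congrFun h0 i.succ))
  intro h0
  apply this
  rw [Finset.sum_eq_single i]
  · simp
    linarith
  · intro j _ hj
    simp [hj]
  · simp

theorem uniformExponent_le_one {N : ℕ} {ξ : Fin N → ℝ} (i : Fin N)
    (hi : ∀ x y : ℤ, x ≠ 0 → ξ i * x - y ≠ 0) : uniformExponent ξ ≤ 1 := by
  refine sSup_le ?_
  rintro _ ⟨l, hl, rfl⟩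
  exact EReal.coe_le_coe_iff.2 (le_one_of_eventually_simultaneouslySolvable i hi hl)

theorem le_uniformExponent {N : ℕ} {ξ : Fin N → ℝ} {l : ℝ}
    (h : ∀ᶠ X : ℝ in atTop, SimultaneouslySolvable ξ l X) : (l : EReal) ≤ uniformExponent ξ :=
  le_sSup ⟨l, h, rfl⟩

theorem eventually_simultaneouslySolvable_of_lt_uniformExponent {N : ℕ} {ξ : Fin N → ℝ} {l : ℝ}
    (h : (l : EReal) < uniformExponent ξ) :
    ∀ᶠ X : ℝ in atTop, SimultaneouslySolvable ξ l X := by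
  obtain ⟨_, ⟨l', hl', rfl⟩, hlt⟩ := lt_sSup_iff.1 h
  filter_upwards [hl', eventually_ge_atTop 1] with X hX hX1
  exact hX.antitone hX1 (EReal.coe_lt_coe_iff.1 hlt).le

theorem mainTheorem9 (n k : ℕ) (hn : 1 ≤ n) (hnk : n ≤ k) (ξ : ℕ → ℝ)
    (hξ : LinearIndependent ℚ (Fin.cons 1 (initialEntries ξ k) : Fin (k + 1) → ℝ))
    (hcond : ((((k : ℝ) - n + 1) / n : ℝ) : EReal) < uniformExponent (initialEntries ξ n)) :
    (uniformExponent (initialEntries ξ n) + (((n : ℝ) - 2 : ℝ) : EReal)) /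
        ((((n : ℝ) - 1) * ((k : ℝ) - 1) : ℝ) : EReal) ≤
      uniformExponent (initialEntries ξ k) ∧
    ((1 / (k : ℝ) : ℝ) : EReal) <
      (uniformExponent (initialEntries ξ n) + (((n : ℝ) - 2 : ℝ) : EReal)) /
        ((((n : ℝ) - 1) * ((k : ℝ) - 1) : ℝ) : EReal) := by
  have hirr : ∀ (i : Fin n) (x y : ℤ), x ≠ 0 → initialEntries ξ n i * x - y ≠ 0 :=
    fun i x y hx => hξ.int_mul_sub_ne_zero (Fin.castLE hnk i) hx y
  have hle : uniformExponent (initialEntries ξ n) ≤ 1 := uniformExponent_le_one ⟨0, hn⟩ (hirr _)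
  have hsolv : ∀ l : ℝ, (l : EReal) < uniformExponent (initialEntries ξ n) →
      ∀ᶠ X : ℝ in atTop, SimultaneouslySolvable (initialEntries ξ n) l X :=
    fun l => eventually_simultaneouslySolvable_of_lt_uniformExponent
  generalize uniformExponent (initialEntries ξ n) = e at hcond hle hsolv ⊢
  lift e to ℝ using ⟨(hle.trans_lt (EReal.coe_lt_top 1)).ne, (bot_le.trans_lt hcond).ne'⟩
  rw [EReal.coe_lt_coe_iff] at hcond
  have he1 : e ≤ 1 := by exact_mod_cast hle
  have hn0 : (0 : ℝ) < n := by exact_mod_cast hn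
  have hnk' : (n : ℝ) ≤ k := by exact_mod_cast hnk
  rw [div_lt_iff₀ hn0] at hcond
  -- For $n=1$ the hypothesis reads $e>k\ge1$, against $e\le1$.
  have hn2 : 2 ≤ n := by
    by_contra! hlt
    obtain rfl : n = 1 := by lia
    rw [Nat.cast_one] at hcond hnk'
    linarith
  have hn2' : (2 : ℝ) ≤ n := by exact_mod_cast hn2
  have hn1 : (0 : ℝ) < n - 1 := by linarith
  have hk1 : (0 : ℝ) < k - 1 := by linarith
  have he0 : 0 < e := by
    by_contra! hneg
    nlinarith
  rw [← EReal.coe_add, ← EReal.coe_div, EReal.coe_lt_coe_iff]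
  constructor
  · have hmain : ∀ μ : ℝ, 0 < μ → μ < (e + (n - 2)) / ((n - 1) * (k - 1)) →
        (μ : EReal) ≤ uniformExponent (initialEntries ξ k) := by
      intro μ hμ0 hμ
      rw [lt_div_iff₀ (mul_pos hn1 hk1)] at hμ
      obtain ⟨l, hl, hle⟩ : ∃ l, max 0 (1 - (n - 1) * (1 - μ * (k - 1))) < l ∧ l < e := by
        refine exists_between (max_lt he0 ?_)
        linarith
      obtain ⟨hl0, hlμ⟩ := max_lt_iff.1 hl
      -- Here $v=1/w$ is the inverse linear form exponent: the lower bound serves the first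
      -- transference, the upper bound the second.
      obtain ⟨v, hv1, hv2⟩ : ∃ v, (1 - l) / (n - 1) < v ∧ v < 1 - μ * (k - 1) := by
        refine exists_between ?_
        rw [div_lt_iff₀ hn1]
        linarith
      rw [div_lt_iff₀ hn1] at hv1
      have hμk : 0 < μ * (k - 1) := mul_pos hμ0 hk1
      have hv0 : 0 < v := by
        by_contra! hneg
        nlinarith
      have hlin := eventually_linearFormSolvable_of_simultaneouslySolvable hn2
        (fun x y hx => ⟨⟨0, hn⟩, hirr _ x (y _) hx⟩) (w := 1 / v) hl0.le (hle.trans_le he1)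
        (by rw [one_div, inv_mul_lt_iff₀ hv0]; exact hv1)
        (hsolv l (EReal.coe_lt_coe_iff.2 hle))
      refine le_uniformExponent (eventually_simultaneouslySolvable_of_linearFormSolvable
        (hn2.trans hnk) hξ.int_linearForm_ne_zero (w := 1 / v) ?_ hμ0 ?_ ?_)
      · rw [lt_div_iff₀ hv0]
        linarith
      · rw [one_div_one_div]
        linarith
      · filter_upwards [hlin, eventually_ge_atTop 0] with Q hQ hQ0
        exact hQ.initialEntries_mono hQ0 hnk
    have htarget : 0 < (e + (n - 2)) / ((n - 1) * (k - 1)) :=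
      div_pos (by linarith) (mul_pos hn1 hk1)
    refine le_of_forall_lt fun c hc => ?_
    obtain ⟨μ, hcμ, hμ⟩ := EReal.lt_iff_exists_real_btwn.1
      (max_lt hc (EReal.coe_lt_coe_iff.2 htarget))
    obtain ⟨hc', hμ0⟩ := max_lt_iff.1 hcμ
    exact hc'.trans_le (hmain μ (EReal.coe_lt_coe_iff.1 hμ0) (EReal.coe_lt_coe_iff.1 hμ))
  · rw [div_lt_div_iff₀ (by linarith) (mul_pos hn1 hk1)]
    -- After clearing denominators the claim is $ke>k-n+1$, which follows from $ne>k-n+1$.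
    have : e * n ≤ e * k := mul_le_mul_of_nonneg_left hnk' he0.le
    linarith
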